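/- Let $L$ be a Riesz space (a real vector lattice, not assumed Archimedean). An element $u\in L$ is called a strong unit if for every $x\in L$ there is a real $\alpha>0$ with $|x|\le\alpha|u|$ (so $u$ need not be positive). Let $e>0$ be a strong unit of $L$. An $e$-component is an element $p\in L$ with $p\wedge(e-p)=0$, and $L$ is called $e$-clean if every $x\in L$ can be written as $x=p+u$ with $p$ an $e$-component and $u$ a strong unit of $L$. A linear functional $H:L\to\mathbb{R}$ is called unital if $H(e)=1$, it preserves units if $H(u)\neq 0$ for every strong unit $u$ of $L$, and it is a Riesz homomorphism if $|H(x)|=H(|x|)$ for all $x\in L$. Theorem. The following are equivalent: (1) every unital linear functional $H:L\to\mathbb{R}$ that preserves units is a Riesz homomorphism; (2) $L$ is $e$-clean. -/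

import Mathlib

/-! A Riesz space is a real ordered vector space whose order is a lattice; here it is given by the
classes `[AddCommGroup L] [Lattice L] [IsOrderedAddMonoid L] [Module ℝ L] [IsOrderedModule ℝ L]`.
No Archimedean property is assumed. -/

namespace RieszSpace

variable {L : Type*} [AddCommGroup L] [Lattice L] [Module ℝ L]

/-- `u` is a strong unit if every `|x|` is bounded by a positive multiple of `|u|`
(`u` itself need not be positive). -/
def IsStrongUnit (u : L) : Prop :=
  ∀ x : L, ∃ α : ℝ, 0 < α ∧ |x| ≤ α • |u|

/-- `p` is an `e`-component if `p ∧ (e - p) = 0`. -/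
def IsComponent (e p : L) : Prop :=
  p ⊓ (e - p) = 0

/-- `x` is `e`-clean if it is the sum of an `e`-component and a strong unit. -/
def IsCleanElement (e x : L) : Prop :=
  ∃ p u : L, IsComponent e p ∧ IsStrongUnit u ∧ x = p + u

/-- A subset is `e`-clean if all of its elements are. -/
def IsCleanSet (e : L) (E : Set L) : Prop :=
  ∀ x ∈ E, IsCleanElement e x

/-- A linear functional is unital (with respect to `e`) if it takes the value `1` at `e`. -/
def IsUnital (e : L) (H : L →ₗ[ℝ] ℝ) : Prop :=
  H e = 1

/-- A linear functional preserves units if it does not vanish at any strong unit. -/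
def PreservesUnits (H : L →ₗ[ℝ] ℝ) : Prop :=
  ∀ u : L, IsStrongUnit u → H u ≠ 0

/-- A linear functional is a Riesz homomorphism if it commutes with the absolute value. -/
def IsRieszHom (H : L →ₗ[ℝ] ℝ) : Prop :=
  ∀ x : L, |H x| = H |x|

end RieszSpace

set_option linter.unusedSectionVars false

namespace RieszSpace

variable {L : Type*} [AddCommGroup L] [Lattice L] [IsOrderedAddMonoid L]
    [Module ℝ L] [IsOrderedModule ℝ L]

/-! ### Disjointness and scalar multiples in a vector lattice -/

section Lattice

/-! Think of `L` as functions on the space of unital Riesz homomorphisms, where strong units are the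
functions without zeros and components are indicators of clopen sets.

Clean implies Riesz: a unital `H` that preserves units is positive and is 0 or 1 on components.
Cleaning `x⁺ ⊓ e` gives a component `p`, and the value of `H p` decides which of `(x - e)⁺`, `x⁻` is
killed. Rescaling `x` then makes `H` vanish on `x⁺` or on `x⁻`.

Riesz implies clean: the mean of two distinct unital homomorphisms is not Riesz, so it kills a
strong unit, whose sign yields a component separating the two (`exists_component_separating`). Two
compactness arguments, run through maximal ideals (`exists_rieszHom_of_directed`), give one
component `p` equal to 1 where `x = 0` and to 0 where `x = e`. Then `x - p` has no zeros. -/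

lemma abs_smul_of_nonneg {c : ℝ} (hc : 0 ≤ c) (x : L) : |c • x| = c • |x| := by
  have key : ∀ {d : ℝ}, 0 ≤ d → ∀ y : L, |d • y| ≤ d • |y| := fun {d} hd y => by
    refine abs_le'.2 ⟨smul_le_smul_of_nonneg_left (le_abs_self y) hd, ?_⟩
    rw [← smul_neg]
    exact smul_le_smul_of_nonneg_left (neg_le_abs y) hd
  rcases hc.eq_or_lt with rfl | hc
  · simp
  refine le_antisymm (key hc.le x) ?_
  have h := smul_le_smul_of_nonneg_left (key (inv_nonneg.2 hc.le) (c • x)) hc.le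
  rwa [smul_smul, smul_smul, inv_mul_cancel₀ hc.ne', mul_inv_cancel₀ hc.ne', one_smul,
    one_smul] at h

lemma abs_smul_le (c : ℝ) (x : L) : |c • x| ≤ |c| • |x| := by
  rcases le_total 0 c with hc | hc
  · rw [abs_smul_of_nonneg hc, abs_of_nonneg hc]
  · rw [← abs_neg, ← neg_smul, abs_smul_of_nonneg (neg_nonneg.2 hc), abs_of_nonpos hc]

lemma inf_add_le_inf_add_inf {a b c : L} (ha : 0 ≤ a) (hb : 0 ≤ b) (hc : 0 ≤ c) :
    a ⊓ (b + c) ≤ a ⊓ b + a ⊓ c := by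
  rw [inf_add, add_inf, add_inf]
  refine le_inf (le_inf ?_ ?_) (le_inf ?_ inf_le_right)
  · exact inf_le_left.trans (le_add_of_nonneg_left ha)
  · exact inf_le_left.trans (le_add_of_nonneg_right hc)
  · exact inf_le_left.trans (le_add_of_nonneg_left hb)

lemma inf_smul_le_smul_inf {a b : L} {c : ℝ} (ha : 0 ≤ a) (hc : 1 ≤ c) :
    a ⊓ c • b ≤ c • (a ⊓ b) := by
  have hc0 : 0 < c := one_pos.trans_le hc
  have h : c⁻¹ • (a ⊓ c • b) ≤ a ⊓ b := by
    refine le_inf ?_ ?_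
    · exact (smul_le_smul_of_nonneg_left inf_le_left (inv_nonneg.2 hc0.le)).trans
        (smul_le_of_le_one_left ha (inv_le_one_of_one_le₀ hc))
    · rw [inv_smul_le_iff_of_pos hc0]
      exact inf_le_right
  rwa [inv_smul_le_iff_of_pos hc0] at h

lemma inf_smul_eq_zero {a b : L} {c : ℝ} (ha : 0 ≤ a) (hb : 0 ≤ b) (h : a ⊓ b = 0)
    (hc : 0 ≤ c) : a ⊓ c • b = 0 := by
  refine le_antisymm ?_ (le_inf ha (smul_nonneg hc hb))
  -- The factor `c + 1` meets the requirement of being at least 1.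
  have h1 : a ⊓ c • b ≤ a ⊓ (c + 1) • b :=
    inf_le_inf_left _ (smul_le_smul_of_nonneg_right (by linarith) hb)
  have h2 := h1.trans (inf_smul_le_smul_inf ha (by linarith))
  rwa [h, smul_zero] at h2

lemma le_of_le_add_of_inf_eq_zero {a b c : L} (ha : 0 ≤ a) (hb : 0 ≤ b) (hc : 0 ≤ c)
    (h : a ≤ b + c) (hab : a ⊓ b = 0) : a ≤ c := by
  have h1 := inf_add_le_inf_add_inf ha hb hc
  rw [inf_eq_left.2 h, hab, zero_add] at h1
  exact h1.trans inf_le_right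

lemma inf_add_eq_zero {a b c : L} (ha : 0 ≤ a) (hb : 0 ≤ b) (hc : 0 ≤ c)
    (hab : a ⊓ b = 0) (hac : a ⊓ c = 0) : a ⊓ (b + c) = 0 := by
  refine le_antisymm ?_ (le_inf ha (add_nonneg hb hc))
  simpa [hab, hac] using inf_add_le_inf_add_inf ha hb hc

lemma inf_eq_zero_of_le {a b c d : L} (ha : 0 ≤ a) (hb : 0 ≤ b) (hac : a ≤ c) (hbd : b ≤ d)
    (h : c ⊓ d = 0) : a ⊓ b = 0 :=
  le_antisymm (h ▸ inf_le_inf hac hbd) (le_inf ha hb)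

end Lattice

/-! ### Strong units and the algebra of components -/

section Units

variable {e : L}

lemma IsStrongUnit.of_le {u : L} {c : ℝ} (he : 0 ≤ e) (hunit : IsStrongUnit e) (hc : 0 < c)
    (h : e ≤ c • |u|) : IsStrongUnit u := fun x => by
  obtain ⟨α, hα, hx⟩ := hunit x
  rw [abs_of_nonneg he] at hx
  refine ⟨α * c, mul_pos hα hc, hx.trans ?_⟩
  rw [mul_smul]
  exact smul_le_smul_of_nonneg_left h hα.le

lemma IsStrongUnit.neg {u : L} (h : IsStrongUnit u) : IsStrongUnit (-u) := fun x => by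
  simpa using h x

/-- Only `0` is disjoint from a strong unit. -/
lemma IsStrongUnit.eq_zero_of_inf_eq_zero {u w a b : L} (hu : IsStrongUnit u) (hw : 0 ≤ w)
    (ha : 0 ≤ a) (hb : 0 ≤ b) (hab : |u| ≤ a + b) (hwa : w ⊓ a = 0) (hwb : w ⊓ b = 0) :
    w = 0 := by
  obtain ⟨α, hα, hx⟩ := hu w
  have h := inf_smul_eq_zero hw (add_nonneg ha hb) (inf_add_eq_zero hw ha hb hwa hwb) hα.le
  rw [abs_of_nonneg hw] at hx
  rwa [inf_eq_left.2 (hx.trans (smul_le_smul_of_nonneg_left hab hα.le))] at h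

lemma IsComponent.nonneg {p : L} (hp : IsComponent e p) : 0 ≤ p := hp ▸ inf_le_left

lemma IsComponent.sub_nonneg {p : L} (hp : IsComponent e p) : 0 ≤ e - p := hp ▸ inf_le_right

lemma IsComponent.inf {p q : L} (hp : IsComponent e p) (hq : IsComponent e q) :
    IsComponent e (p ⊓ q) := by
  have h0 : 0 ≤ p ⊓ q := le_inf hp.nonneg hq.nonneg
  refine inf_eq_zero_of_le h0 (_root_.sub_nonneg.2 (inf_le_left.trans
    (_root_.sub_nonneg.1 hp.sub_nonneg))) le_rfl ?_
    (inf_add_eq_zero h0 hp.sub_nonneg hq.sub_nonneg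
      (inf_eq_zero_of_le h0 hp.sub_nonneg inf_le_left le_rfl hp)
      (inf_eq_zero_of_le h0 hq.sub_nonneg inf_le_right le_rfl hq))
  rw [sub_inf]
  exact sup_le (le_add_of_nonneg_right hq.sub_nonneg) (le_add_of_nonneg_left hp.sub_nonneg)

lemma IsComponent.compl {p : L} (hp : IsComponent e p) : IsComponent e (e - p) := by
  rw [IsComponent, sub_sub_cancel, inf_comm]
  exact hp

lemma IsComponent.sup {p q : L} (hp : IsComponent e p) (hq : IsComponent e q) :
    IsComponent e (p ⊔ q) := by
  have h := (hp.compl.inf hq.compl).compl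
  rwa [sub_inf, sub_sub_cancel, sub_sub_cancel] at h

lemma sub_posPart_inf_le_negPart {v : L} (hv : e ≤ |v|) : e - v⁺ ⊓ e ≤ v⁻ := by
  rw [sub_inf, sub_self]
  refine sup_le ?_ (negPart_nonneg v)
  rwa [sub_le_iff_le_add', posPart_add_negPart]

/-- If `e ≤ |v|`, then `v⁺ ⊓ e` is a component. -/
lemma isComponent_posPart_inf {v : L} (he : 0 ≤ e) (hv : e ≤ |v|) : IsComponent e (v⁺ ⊓ e) :=
  inf_eq_zero_of_le (le_inf (posPart_nonneg v) he) (sub_nonneg.2 inf_le_right) inf_le_left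
    (sub_posPart_inf_le_negPart hv) (posPart_inf_negPart_eq_zero v)

end Units

/-! ### Unit-preserving functionals on a clean space -/

section CleanImpliesRiesz

variable {e : L} {H : L →ₗ[ℝ] ℝ}

/-- Otherwise `x + (-H x) • e` dominates a positive multiple of `e`, yet `H` kills it. -/
lemma PreservesUnits.nonneg (he : 0 < e) (hunit : IsStrongUnit e) (h1 : IsUnital e H)
    (hH : PreservesUnits H) {x : L} (hx : 0 ≤ x) : 0 ≤ H x := by
  by_contra! hneg
  have hle : (-H x) • e ≤ x + (-H x) • e := le_add_of_nonneg_left hx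
  have hpos : 0 ≤ (-H x) • e := smul_nonneg (by linarith) he.le
  refine hH (x + (-H x) • e) (.of_le (c := (-H x)⁻¹) he.le hunit
    (inv_pos.2 (by linarith)) ?_) ?_
  · rw [abs_of_nonneg (hpos.trans hle)]
    have h := smul_le_smul_of_nonneg_left hle (inv_nonneg.2 (by linarith : 0 ≤ -H x))
    rwa [smul_smul, inv_mul_cancel₀ (by linarith), one_smul] at h
  · rw [map_add, map_smul, h1]
    simp

lemma map_mono_of_nonneg (hH : ∀ x, 0 ≤ x → 0 ≤ H x) {x y : L} (h : x ≤ y) : H x ≤ H y := by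
  have := hH (y - x) (sub_nonneg.2 h)
  rw [map_sub] at this
  linarith

lemma eq_zero_of_map_le (hH : ∀ x, 0 ≤ x → 0 ≤ H x) {x y : L} {c : ℝ} (hx : 0 ≤ x)
    (hy : H y = 0) (h : x ≤ c • y) : H x = 0 := by
  refine le_antisymm ?_ (hH x hx)
  simpa [hy] using map_mono_of_nonneg hH h

/-- Being disjoint from `e - p`, `w` lies in the ideal generated by `p`. -/
lemma eq_zero_of_inf_compl {w p : L} (he : 0 ≤ e) (hunit : IsStrongUnit e)
    (hH : ∀ x, 0 ≤ x → 0 ≤ H x) (hp : IsComponent e p) (hw : 0 ≤ w) (h : w ⊓ (e - p) = 0)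
    (hHp : H p = 0) : H w = 0 := by
  obtain ⟨α, hα, hx⟩ := hunit w
  rw [abs_of_nonneg hw, abs_of_nonneg he] at hx
  refine eq_zero_of_map_le hH hw hHp (c := α) ?_
  refine le_of_le_add_of_inf_eq_zero hw (smul_nonneg hα.le hp.sub_nonneg)
    (smul_nonneg hα.le hp.nonneg) ?_ (inf_smul_eq_zero hw hp.sub_nonneg h hα.le)
  rwa [← smul_add, sub_add_cancel]

lemma PreservesUnits.component_eq (he : 0 < e) (hunit : IsStrongUnit e) (h1 : IsUnital e H)
    (hH : PreservesUnits H) {p : L} (hp : IsComponent e p) : H p = 0 ∨ H p = 1 := by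
  by_contra! hne
  have h0 : 0 < H p := lt_of_le_of_ne (hH.nonneg he hunit h1 hp.nonneg) hne.1.symm
  have h2 : 0 < 1 - H p := by
    refine lt_of_le_of_ne ?_ (sub_ne_zero.2 hne.2.symm).symm
    simpa [h1.symm] using hH.nonneg he hunit h1 hp.sub_nonneg
  obtain ⟨t, ht⟩ : ∃ t, t = H p := ⟨_, rfl⟩
  rw [← ht] at h0 h2
  -- A difference of disjoint positive elements: its absolute value dominates both, so it is a
  -- strong unit, killed by `H`.
  have h3 : p - t • e = (1 - t) • p - t • (e - p) := by module
  have ha : 0 ≤ (1 - t) • p := smul_nonneg h2.le hp.nonneg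
  have hb : 0 ≤ t • (e - p) := smul_nonneg h0.le hp.sub_nonneg
  have hd : ((1 - t) • p) ⊓ (t • (e - p)) = 0 := by
    refine inf_smul_eq_zero ha hp.sub_nonneg ?_ h0.le
    rw [inf_comm]
    refine inf_smul_eq_zero hp.sub_nonneg hp.nonneg ?_ h2.le
    rw [inf_comm]; exact hp
  have hle : (1 - t) • p ≤ |p - t • e| := by
    refine le_of_le_add_of_inf_eq_zero ha hb (abs_nonneg _) ?_ hd
    rw [h3, ← sub_le_iff_le_add']
    exact le_abs_self _
  have hle' : t • (e - p) ≤ |p - t • e| := by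
    refine le_of_le_add_of_inf_eq_zero hb ha (abs_nonneg _) ?_ (by rw [inf_comm]; exact hd)
    rw [h3, ← sub_le_iff_le_add', abs_sub_comm]
    exact le_abs_self _
  refine hH (p - t • e) (.of_le (c := (1 - t)⁻¹ + t⁻¹) he.le hunit
    (add_pos (inv_pos.2 h2) (inv_pos.2 h0)) ?_) ?_
  · have k1 := smul_le_smul_of_nonneg_left hle (inv_nonneg.2 h2.le)
    have k2 := smul_le_smul_of_nonneg_left hle' (inv_nonneg.2 h0.le)
    rw [smul_smul, inv_mul_cancel₀ h2.ne', one_smul] at k1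
    rw [smul_smul, inv_mul_cancel₀ h0.ne', one_smul] at k2
    rw [add_smul]
    simpa using add_le_add k1 k2
  · have h1' : H e = 1 := h1
    simp [h1', ht]

/-- With `x⁺ ⊓ e = p + u`, the unit `u` would vanish on the part of `x⁻` outside `p` and on the part
of `(x - e)⁺` inside `p`, so both parts are zero. -/
lemma eq_zero_or_eq_zero_of_isCleanSet (he : 0 < e) (hunit : IsStrongUnit e)
    (hclean : IsCleanSet e (Set.univ : Set L)) (h1 : IsUnital e H) (hH : PreservesUnits H)
    (x : L) : H (x - e)⁺ = 0 ∨ H x⁻ = 0 := by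
  have h1' : H e = 1 := h1
  obtain ⟨p, u, hp, hu, hf⟩ := hclean (x⁺ ⊓ e) trivial
  have hpos : ∀ x, 0 ≤ x → 0 ≤ H x := fun x => hH.nonneg he hunit h1
  have hf0 : 0 ≤ x⁺ ⊓ e := le_inf (posPart_nonneg x) he.le
  have hf1 : 0 ≤ e - x⁺ ⊓ e := sub_nonneg.2 inf_le_right
  have hle : e - x⁺ ⊓ e ≤ (x - e)⁻ := by
    rw [sub_inf, sub_self, negPart_def, neg_sub]
    exact sup_le_sup_right (sub_le_sub_left (le_posPart x) e) 0
  rcases hH.component_eq he hunit h1 hp with h0 | h0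
  · right
    refine eq_zero_of_inf_compl he.le hunit hpos hp (negPart_nonneg x) ?_ h0
    have hw : 0 ≤ x⁻ ⊓ (e - p) := le_inf (negPart_nonneg x) hp.sub_nonneg
    refine hu.eq_zero_of_inf_eq_zero hw hf0 hp.nonneg ?_ ?_ ?_
    · rw [show u = x⁺ ⊓ e - p by rw [hf]; abel]
      exact abs_le'.2 ⟨(sub_le_self _ hp.nonneg).trans (le_add_of_nonneg_right hp.nonneg),
        by rw [neg_sub]; exact (sub_le_self _ hf0).trans (le_add_of_nonneg_left hf0)⟩
    · exact inf_eq_zero_of_le hw hf0 inf_le_left inf_le_left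
        ((inf_comm _ _).trans (posPart_inf_negPart_eq_zero x))
    · exact inf_eq_zero_of_le hw hp.nonneg inf_le_right le_rfl ((inf_comm _ _).trans hp)
  · left
    refine eq_zero_of_inf_compl he.le hunit hpos hp.compl (posPart_nonneg _) ?_ (by simp [h0, h1'])
    rw [sub_sub_cancel]
    have hw : 0 ≤ (x - e)⁺ ⊓ p := le_inf (posPart_nonneg _) hp.nonneg
    refine hu.eq_zero_of_inf_eq_zero hw hf1 hp.sub_nonneg ?_ ?_ ?_
    · rw [show u = (e - p) - (e - x⁺ ⊓ e) by rw [hf]; abel]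
      exact abs_le'.2 ⟨(sub_le_self _ hf1).trans (le_add_of_nonneg_left hf1),
        by rw [neg_sub]; exact (sub_le_self _ hp.sub_nonneg).trans
            (le_add_of_nonneg_right hp.sub_nonneg)⟩
    · exact inf_eq_zero_of_le hw hf1 inf_le_left hle (posPart_inf_negPart_eq_zero _)
    · exact inf_eq_zero_of_le hw hp.sub_nonneg inf_le_right le_rfl hp

theorem isRieszHom_of_isCleanSet (he : 0 < e) (hunit : IsStrongUnit e)
    (hclean : IsCleanSet e (Set.univ : Set L)) (h1 : IsUnital e H) (hH : PreservesUnits H) :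
    IsRieszHom H := fun x => by
  have h1' : H e = 1 := h1
  have hpos : ∀ x, 0 ≤ x → 0 ≤ H x := fun x => hH.nonneg he hunit h1
  have hp := hpos x⁺ (posPart_nonneg x)
  have hn := hpos x⁻ (negPart_nonneg x)
  have hsub : H x = H x⁺ - H x⁻ := by rw [← map_sub, posPart_sub_negPart]
  rw [← posPart_add_negPart x, map_add, hsub]
  rcases hn.eq_or_lt with h0 | h0
  · rw [← h0, sub_zero, add_zero, abs_of_nonneg hp]
  suffices H x⁺ = 0 by rw [this, zero_sub, zero_add, abs_neg, abs_of_nonneg hn]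
  by_contra hne
  have hp' : 0 < H x⁺ := lt_of_le_of_ne hp (Ne.symm hne)
  have hc : 0 < 2 / H x⁺ := by positivity
  -- Scaled so that `H (c • x⁺) = 2`, more than the value 1 of `H e`.
  obtain ⟨c, hcdef⟩ : ∃ c, c = 2 / H x⁺ := ⟨_, rfl⟩
  rw [← hcdef] at hc
  rcases eq_zero_or_eq_zero_of_isCleanSet he hunit hclean h1 hH (c • x) with h | h
  · have hle : c • x⁺ ≤ (c • x - e)⁺ + e := by
      have h2 : x ≤ c⁻¹ • ((c • x - e)⁺ + e) := by
        rw [← one_smul ℝ x, ← inv_mul_cancel₀ hc.ne', mul_smul]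
        refine smul_le_smul_of_nonneg_left ?_ (inv_nonneg.2 hc.le)
        rw [smul_smul, smul_smul, mul_inv_cancel₀ hc.ne', one_mul, ← sub_le_iff_le_add]
        exact le_posPart _
      have h3 : x⁺ ≤ c⁻¹ • ((c • x - e)⁺ + e) :=
        sup_le h2 (smul_nonneg (inv_nonneg.2 hc.le) (add_nonneg (posPart_nonneg _) he.le))
      have h4 := smul_le_smul_of_nonneg_left h3 hc.le
      rwa [smul_smul, mul_inv_cancel₀ hc.ne', one_smul] at h4
    have h5 := map_mono_of_nonneg hpos hle
    rw [map_smul, map_add, h, h1', hcdef, smul_eq_mul, div_mul_cancel₀ _ hne] at h5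
    norm_num at h5
  · have hle : x⁻ ≤ c⁻¹ • (c • x)⁻ := by
      refine sup_le ?_ (smul_nonneg (inv_nonneg.2 hc.le) (negPart_nonneg _))
      have h2 := smul_le_smul_of_nonneg_left (neg_le_negPart (c • x)) (inv_nonneg.2 hc.le)
      rwa [← smul_neg, smul_smul, inv_mul_cancel₀ hc.ne', one_smul] at h2
    exact h0.ne' (eq_zero_of_map_le hpos (negPart_nonneg x) h hle)

end CleanImpliesRiesz

/-! ### Maximal ideals and unital Riesz homomorphisms -/

section MaximalIdeals

variable {e : L}

/-- An order ideal: a subspace that is solid. -/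
def IsSolid (M : Submodule ℝ L) : Prop :=
  ∀ ⦃x y : L⦄, x ∈ M → |y| ≤ |x| → y ∈ M

lemma IsSolid.abs_mem {M : Submodule ℝ L} (hM : IsSolid M) {x : L} (hx : x ∈ M) : |x| ∈ M :=
  hM hx (abs_abs x).le

lemma IsSolid.mem_of_le {M : Submodule ℝ L} (hM : IsSolid M) {x y : L} (hx : x ∈ M)
    (hy : 0 ≤ y) (h : y ≤ x) : y ∈ M :=
  hM hx (by rwa [abs_of_nonneg hy, abs_of_nonneg (hy.trans h)])

/-- The order ideal generated by a nonempty set of positive elements that is directed up to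
positive multiples. -/
def directedIdeal (S : Set L) (hne : S.Nonempty) (h0 : ∀ a ∈ S, 0 ≤ a)
    (hdir : ∀ a ∈ S, ∀ b ∈ S, ∃ c ∈ S, ∃ C : ℝ, 0 ≤ C ∧ a + b ≤ C • c) : Submodule ℝ L where
  carrier := {y | ∃ a ∈ S, ∃ C : ℝ, 0 ≤ C ∧ |y| ≤ C • a}
  zero_mem' := hne.imp fun a ha => ⟨ha, 0, le_rfl, by simp⟩
  add_mem' := by
    rintro y z ⟨a, ha, C, hC, hy⟩ ⟨b, hb, D, hD, hz⟩
    obtain ⟨c, hc, E, hE, hab⟩ := hdir a ha b hb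
    refine ⟨c, hc, (C + D) * E, by positivity, (abs_add_le y z).trans ?_⟩
    rw [mul_smul]
    refine le_trans ?_ (smul_le_smul_of_nonneg_left hab (by positivity))
    rw [smul_add]
    exact add_le_add
      (hy.trans (smul_le_smul_of_nonneg_right (by linarith) (h0 a ha)))
      (hz.trans (smul_le_smul_of_nonneg_right (by linarith) (h0 b hb)))
  smul_mem' := by
    rintro t y ⟨a, ha, C, hC, hy⟩
    refine ⟨a, ha, |t| * C, by positivity, (abs_smul_le t y).trans ?_⟩
    rw [mul_smul]
    exact smul_le_smul_of_nonneg_left hy (abs_nonneg t)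

lemma isSolid_directedIdeal (S : Set L) (hne : S.Nonempty) (h0 : ∀ a ∈ S, 0 ≤ a)
    (hdir : ∀ a ∈ S, ∀ b ∈ S, ∃ c ∈ S, ∃ C : ℝ, 0 ≤ C ∧ a + b ≤ C • c) :
    IsSolid (directedIdeal S hne h0 hdir) := by
  rintro x y ⟨a, ha, C, hC, hx⟩ hxy
  exact ⟨a, ha, C, hC, hxy.trans hx⟩

/-- A maximal element among the order ideals that avoid `e`. -/
def IsMaximalIdeal (e : L) (M : Submodule ℝ L) : Prop :=
  Maximal (fun N : Submodule ℝ L => IsSolid N ∧ e ∉ N) M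

lemma exists_le_isMaximalIdeal {I : Submodule ℝ L} (hI : IsSolid I) (heI : e ∉ I) :
    ∃ M, I ≤ M ∧ IsMaximalIdeal e M := by
  refine zorn_le_nonempty₀ {N : Submodule ℝ L | IsSolid N ∧ e ∉ N} ?_ I ⟨hI, heI⟩
  intro c hc hchain N hN
  have hmem : ∀ z, z ∈ sSup c ↔ ∃ y ∈ c, z ∈ y := fun z =>
    Submodule.mem_sSup_of_directed ⟨N, hN⟩ hchain.directedOn
  refine ⟨sSup c, ⟨?_, ?_⟩, fun z hz => le_sSup hz⟩
  · intro x y hx hxy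
    obtain ⟨K, hK, hxK⟩ := (hmem x).1 hx
    exact (hmem y).2 ⟨K, hK, (hc hK).1 hxK hxy⟩
  · rintro h
    obtain ⟨K, hK, hxK⟩ := (hmem e).1 h
    exact (hc hK).2 hxK

variable {M : Submodule ℝ L}

/-- By maximality, the ideal generated by `M` and `y` contains `e`. -/
lemma IsMaximalIdeal.exists_le (hM : IsMaximalIdeal e M) (he : 0 ≤ e) {y : L} (hy : 0 ≤ y)
    (hyM : y ∉ M) :
    ∃ m ∈ M, 0 ≤ m ∧ ∃ C : ℝ, 0 ≤ C ∧ e ≤ m + C • y := by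
  have hs := hM.prop.1
  let S : Set L := {a | ∃ m ∈ M, 0 ≤ m ∧ a = m + y}
  have hne : S.Nonempty := ⟨0 + y, 0, M.zero_mem, le_rfl, rfl⟩
  have h0 : ∀ a ∈ S, 0 ≤ a := by
    rintro _ ⟨m, -, hm, rfl⟩
    exact add_nonneg hm hy
  have hdir : ∀ a ∈ S, ∀ b ∈ S, ∃ c ∈ S, ∃ C : ℝ, 0 ≤ C ∧ a + b ≤ C • c := by
    rintro _ ⟨m, hmM, hm, rfl⟩ _ ⟨n, hnM, hn, rfl⟩
    refine ⟨_, ⟨m + n, M.add_mem hmM hnM, add_nonneg hm hn, rfl⟩, 2, by norm_num, ?_⟩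
    rw [show (2 : ℝ) • (m + n + y) = (m + y + (n + y)) + (m + n) by module]
    exact le_add_of_nonneg_right (add_nonneg hm hn)
  let N := directedIdeal S hne h0 hdir
  have hle : M ≤ N := fun z hz => ⟨_, ⟨|z|, hs.abs_mem hz, abs_nonneg z, rfl⟩, 1, zero_le_one,
    by rw [one_smul]; exact le_add_of_nonneg_right hy⟩
  have hyN : y ∈ N := ⟨_, ⟨0, M.zero_mem, le_rfl, rfl⟩, 1, zero_le_one,
    by rw [abs_of_nonneg hy, one_smul, zero_add]⟩
  have heN : e ∈ N := by
    by_contra h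
    exact hyM (hM.le_of_ge ⟨isSolid_directedIdeal S hne h0 hdir, h⟩ hle hyN)
  obtain ⟨_, ⟨m, hmM, hm, rfl⟩, C, hC, h⟩ := heN
  rw [abs_of_nonneg he, smul_add] at h
  exact ⟨C • m, M.smul_mem C hmM, smul_nonneg hC hm, C, hC, h⟩

lemma IsMaximalIdeal.mem_or_mem (hM : IsMaximalIdeal e M) (he : 0 ≤ e) (hunit : IsStrongUnit e)
    {x y : L} (hx : 0 ≤ x) (hy : 0 ≤ y) (h : x ⊓ y = 0) : x ∈ M ∨ y ∈ M := by
  by_contra! hne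
  obtain ⟨m, hmM, hm, C, hC, hle⟩ := hM.exists_le he hx hne.1
  obtain ⟨α, hα, hle'⟩ := hunit y
  rw [abs_of_nonneg hy, abs_of_nonneg he] at hle'
  refine hne.2 (hM.prop.1.mem_of_le (M.smul_mem α hmM) hy ?_)
  have h2 := hle'.trans (smul_le_smul_of_nonneg_left hle hα.le)
  rw [smul_add, add_comm, smul_smul] at h2
  rw [inf_comm] at h
  exact le_of_le_add_of_inf_eq_zero hy (smul_nonneg (by positivity) hx) (smul_nonneg hα.le hm) h2
    (inf_smul_eq_zero hy hx h (by positivity))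

/-- The quotient by `M` is Archimedean even if `L` is not. -/
lemma IsMaximalIdeal.mem_of_forall_le (hM : IsMaximalIdeal e M) (he : 0 ≤ e) {y : L}
    (hy : 0 ≤ y) (h : ∀ ε : ℝ, 0 < ε → ∃ m ∈ M, y ≤ m + ε • e) : y ∈ M := by
  by_contra hyM
  obtain ⟨m, hmM, hm, C, hC, hle⟩ := hM.exists_le he hy hyM
  -- Chosen so that `C * ε ≤ 1/2`, leaving half of `e` to be absorbed.
  obtain ⟨n, hnM, hn⟩ := h (2 * (C + 1))⁻¹ (by positivity)
  have h1 : e ≤ (m + C • n) + (2⁻¹ : ℝ) • e := by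
    refine hle.trans ?_
    rw [add_assoc]
    refine add_le_add_right ((smul_le_smul_of_nonneg_left hn hC).trans ?_) m
    rw [smul_add, smul_smul]
    refine add_le_add_right (smul_le_smul_of_nonneg_right ?_ he) _
    rw [← div_eq_mul_inv, div_le_iff₀ (by positivity)]
    linarith
  have h2 : e ≤ (2 : ℝ) • (m + C • n) := by
    have h3 := smul_le_smul_of_nonneg_left (sub_le_iff_le_add.2 h1) (zero_le_two (α := ℝ))
    rwa [show (2 : ℝ) • (e - (2⁻¹ : ℝ) • e) = e by module] at h3
  exact hM.prop.2 (hM.prop.1.mem_of_le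
    (M.smul_mem _ (M.add_mem hmM (M.smul_mem _ hnM))) he h2)

lemma mem_of_posPart_negPart {x : L} (hp : x⁺ ∈ M) (hn : x⁻ ∈ M) : x ∈ M := by
  rw [← posPart_sub_negPart x]
  exact M.sub_mem hp hn

lemma IsMaximalIdeal.exists_sub_smul_mem (hM : IsMaximalIdeal e M) (he : 0 ≤ e)
    (hunit : IsStrongUnit e) (x : L) : ∃ t : ℝ, x - t • e ∈ M := by
  -- The upper bounds of `x` modulo `M`; the infimum is the value sought.
  let T : Set ℝ := {t | (x - t • e)⁺ ∈ M}
  obtain ⟨α, hα, hx⟩ := hunit x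
  rw [abs_of_nonneg he] at hx
  have hα_mem : α ∈ T := by
    have : (x - α • e)⁺ = 0 :=
      posPart_eq_zero.2 (sub_nonpos.2 ((le_abs_self x).trans hx))
    change (x - α • e)⁺ ∈ M
    rw [this]
    exact M.zero_mem
  have hshift : ∀ s t : ℝ, t ≤ s → (x - t • e)⁺ ≤ (x - s • e)⁺ + (s - t) • e := fun s t hst => by
    refine sup_le ?_ (add_nonneg (posPart_nonneg _) (smul_nonneg (by linarith) he))
    rw [show x - t • e = (x - s • e) + (s - t) • e by module]
    exact add_le_add_left (le_posPart _) _
  have hbdd : BddBelow T := by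
    refine ⟨-α - 1, fun s hs => ?_⟩
    by_contra! hlt
    have h1 : e ≤ (x - s • e)⁺ := by
      refine le_trans ?_ (le_posPart _)
      have h2 : -(α • e) ≤ x := neg_le.1 ((neg_le_abs x).trans hx)
      rw [le_sub_iff_add_le]
      refine le_trans ?_ h2
      rw [← neg_smul]
      nth_rewrite 1 [← one_smul ℝ e]
      rw [← add_smul]
      exact smul_le_smul_of_nonneg_right (by linarith) he
    exact hM.prop.2 (hM.prop.1.mem_of_le hs he h1)
  refine ⟨sInf T, mem_of_posPart_negPart ?_ ?_⟩
  · refine hM.mem_of_forall_le he (posPart_nonneg _) fun ε hε => ?_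
    obtain ⟨s, hs, hlt⟩ := exists_lt_of_csInf_lt ⟨α, hα_mem⟩ (lt_add_of_pos_right (sInf T) hε)
    have hle : sInf T ≤ s := csInf_le hbdd hs
    refine ⟨_, hs, (hshift s _ hle).trans (add_le_add_right ?_ _)⟩
    exact smul_le_smul_of_nonneg_right (by linarith) he
  · refine hM.mem_of_forall_le he (negPart_nonneg _) fun ε hε => ?_
    have hnot : sInf T - ε ∉ T := fun h => by linarith [csInf_le hbdd h]
    refine ⟨(x - (sInf T - ε) • e)⁻, (hM.mem_or_mem he hunit (posPart_nonneg _)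
      (negPart_nonneg _) (posPart_inf_negPart_eq_zero _)).resolve_left hnot, ?_⟩
    refine sup_le ?_ (add_nonneg (negPart_nonneg _) (smul_nonneg hε.le he))
    rw [show -(x - sInf T • e) = -(x - (sInf T - ε) • e) + ε • e by module]
    exact add_le_add_left (neg_le_negPart _) _

/-- A maximal ideal is the kernel of a unital Riesz homomorphism. -/
lemma IsMaximalIdeal.exists_rieszHom (hM : IsMaximalIdeal e M) (he : 0 ≤ e)
    (hunit : IsStrongUnit e) :
    ∃ φ : L →ₗ[ℝ] ℝ, IsUnital e φ ∧ IsRieszHom φ ∧ ∀ x ∈ M, φ x = 0 := by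
  choose f hf using hM.exists_sub_smul_mem he hunit
  have huniq : ∀ {x : L} {t : ℝ}, x - t • e ∈ M → f x = t := fun {x t} ht => by
    by_contra hne
    have h := M.sub_mem ht (hf x)
    rw [show x - t • e - (x - f x • e) = (f x - t) • e by module] at h
    exact hM.prop.2 ((M.smul_mem_iff (sub_ne_zero.2 hne)).1 h)
  refine ⟨{ toFun := f, map_add' := fun x y => huniq ?_, map_smul' := fun c x => huniq ?_ },
    huniq ?_, fun x => (huniq ?_).symm, fun x hx => huniq ?_⟩
  · rw [show x + y - (f x + f y) • e = (x - f x • e) + (y - f y • e) by module]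
    exact M.add_mem (hf x) (hf y)
  · rw [show c • x - ((RingHom.id ℝ) c • f x) • e = c • (x - f x • e) by
      simp only [RingHom.id_apply, smul_eq_mul]; module]
    exact M.smul_mem c (hf x)
  · simp
  · have h : |f x| • e = |f x • e| := by
      rcases le_total 0 (f x) with h | h
      · rw [abs_smul_of_nonneg h, abs_of_nonneg h, abs_of_nonneg he]
      · rw [abs_of_nonpos h, ← abs_neg (f x • e), ← neg_smul,
          abs_smul_of_nonneg (neg_nonneg.2 h), abs_of_nonneg he]
    change |x| - |f x| • e ∈ M
    rw [h]
    exact hM.prop.1 (hf x) (abs_abs_sub_abs_le x (f x • e))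
  · simpa using hx

/-- Compactness in algebraic form: if no single member of `S` dominates `e` up to scaling, all
members have a common zero. -/
lemma exists_rieszHom_of_directed (he : 0 ≤ e) (hunit : IsStrongUnit e) (S : Set L)
    (hne : S.Nonempty) (h0 : ∀ a ∈ S, 0 ≤ a)
    (hdir : ∀ a ∈ S, ∀ b ∈ S, ∃ c ∈ S, ∃ C : ℝ, 0 ≤ C ∧ a + b ≤ C • c)
    (hS : ∀ a ∈ S, ∀ C : ℝ, 0 ≤ C → ¬ e ≤ C • a) :
    ∃ φ : L →ₗ[ℝ] ℝ, IsUnital e φ ∧ IsRieszHom φ ∧ ∀ a ∈ S, φ a = 0 := by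
  obtain ⟨M, hle, hM⟩ := exists_le_isMaximalIdeal (e := e)
    (isSolid_directedIdeal S hne h0 hdir) (by
      rintro ⟨a, ha, C, hC, h⟩
      rw [abs_of_nonneg he] at h
      exact hS a ha C hC h)
  obtain ⟨φ, h1, h2, h3⟩ := hM.exists_rieszHom he hunit
  exact ⟨φ, h1, h2, fun a ha => h3 a (hle ⟨a, ha, 1, zero_le_one,
    by rw [one_smul, abs_of_nonneg (h0 a ha)]⟩)⟩

end MaximalIdeals

/-! ### Separation by components -/

section RieszImpliesClean

variable {e : L}

lemma IsRieszHom.nonneg {φ : L →ₗ[ℝ] ℝ} (hφ : IsRieszHom φ) (x : L) (hx : 0 ≤ x) : 0 ≤ φ x := by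
  rw [← abs_of_nonneg hx, ← hφ x]
  exact abs_nonneg _

lemma IsRieszHom.map_negPart {φ : L →ₗ[ℝ] ℝ} (hφ : IsRieszHom φ) {x : L} (hx : 0 ≤ φ x) :
    φ x⁻ = 0 := by
  have h1 : φ x⁺ - φ x⁻ = φ x := by rw [← map_sub, posPart_sub_negPart]
  have h2 : φ x⁺ + φ x⁻ = φ |x| := by rw [← map_add, posPart_add_negPart]
  rw [← hφ x, abs_of_nonneg hx] at h2
  linarith

lemma IsRieszHom.map_posPart {φ : L →ₗ[ℝ] ℝ} (hφ : IsRieszHom φ) {x : L} (hx : φ x ≤ 0) :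
    φ x⁺ = 0 := by
  rw [← neg_neg x, posPart_neg]
  exact hφ.map_negPart (by rw [map_neg]; linarith)

/-- Distinct unital Riesz homomorphisms are separated by a component. -/
lemma exists_component_separating (he : 0 < e)
    (h : ∀ H : L →ₗ[ℝ] ℝ, IsUnital e H → PreservesUnits H → IsRieszHom H)
    {φ ψ : L →ₗ[ℝ] ℝ} (hφ1 : IsUnital e φ) (hφ : IsRieszHom φ) (hψ1 : IsUnital e ψ)
    (hψ : IsRieszHom ψ) {x : L} (hφx : φ x = 0) (hψx : ψ x = 1) :
    ∃ p, IsComponent e p ∧ φ (e - p) = 0 ∧ ψ p = 0 := by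
  have hφ1' : φ e = 1 := hφ1
  have hψ1' : ψ e = 1 := hψ1
  let H : L →ₗ[ℝ] ℝ := (1 / 2 : ℝ) • (φ + ψ)
  have hHval : ∀ y, H y = 1 / 2 * (φ y + ψ y) := fun y => rfl
  have hnot : ¬ IsRieszHom H := fun hR => by
    -- Here `φ` and `ψ` take the values `-1/2` and `1/2`, which cancel in `H` but not after absolute
    -- values.
    have h1 := hR (x - (1 / 2 : ℝ) • e)
    rw [hHval, hHval, ← hφ, ← hψ] at h1
    simp only [map_sub, map_smul, hφx, hψx, hφ1', hψ1', smul_eq_mul] at h1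
    norm_num at h1
  have hnp : ¬ PreservesUnits H := fun hP =>
    hnot (h H (by change H e = 1; rw [hHval, hφ1', hψ1']; norm_num) hP)
  simp only [PreservesUnits, not_forall, not_not] at hnp
  obtain ⟨u, hu, hu0⟩ := hnp
  have key : ∀ v : L, IsStrongUnit v → H v = 0 → 0 ≤ φ v →
      ∃ p, IsComponent e p ∧ φ (e - p) = 0 ∧ ψ p = 0 := by
    intro v hv hv0 hφv
    obtain ⟨α, hα, hle⟩ := hv e
    rw [abs_of_nonneg he.le, ← abs_smul_of_nonneg hα.le] at hle
    have hp := isComponent_posPart_inf he.le hle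
    rw [hHval] at hv0
    refine ⟨_, hp, eq_zero_of_map_le hφ.nonneg (c := 1) hp.sub_nonneg
      (hφ.map_negPart (x := α • v) ?_) ?_, eq_zero_of_map_le hψ.nonneg (c := 1) hp.nonneg
      (hψ.map_posPart (x := α • v) ?_) ?_⟩
    · rw [map_smul]; exact mul_nonneg hα.le hφv
    · rw [one_smul]; exact sub_posPart_inf_le_negPart hle
    · rw [map_smul]; exact mul_nonpos_of_nonneg_of_nonpos hα.le (by linarith)
    · rw [one_smul]; exact inf_le_left
  rcases le_total 0 (φ u) with h0 | h0
  · exact key u hu hu0 h0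
  · exact key (-u) hu.neg (by rw [map_neg, hu0, neg_zero]) (by rw [map_neg]; linarith)

/-- A unital Riesz homomorphism vanishing at `x` admits a component at which it takes the value
`1` and which stays away from the set where `x` equals `e`. -/
lemma exists_component_of_map_eq_zero (he : 0 < e) (hunit : IsStrongUnit e)
    (h : ∀ H : L →ₗ[ℝ] ℝ, IsUnital e H → PreservesUnits H → IsRieszHom H)
    {φ : L →ₗ[ℝ] ℝ} (hφ1 : IsUnital e φ) (hφ : IsRieszHom φ) {x : L} (hφx : φ x = 0) :
    ∃ p, IsComponent e p ∧ φ (e - p) = 0 ∧ ∃ C : ℝ, 0 ≤ C ∧ e ≤ C • (|x - e| + (e - p)) := by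
  by_contra! hcon
  -- A common zero `ψ` of `S` has `ψ x = 1` and `ψ p = 1` whenever `φ p = 1`, against separation
  -- from `φ`.
  let S : Set L := {a | ∃ p, IsComponent e p ∧ φ (e - p) = 0 ∧ a = |x - e| + (e - p)}
  have heS : |x - e| + (e - e) ∈ S := ⟨e, by simp [IsComponent, he.le], by simp, rfl⟩
  obtain ⟨ψ, hψ1, hψ, hψS⟩ := exists_rieszHom_of_directed he.le hunit S ⟨_, heS⟩
    (by
      rintro _ ⟨p, hp, -, rfl⟩
      exact add_nonneg (abs_nonneg _) hp.sub_nonneg)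
    (by
      rintro _ ⟨p, hp, hp0, rfl⟩ _ ⟨q, hq, hq0, rfl⟩
      have hle : e - p ⊓ q ≤ (e - p) + (e - q) := by
        rw [sub_inf]
        exact sup_le (le_add_of_nonneg_right hq.sub_nonneg)
          (le_add_of_nonneg_left hp.sub_nonneg)
      refine ⟨_, ⟨p ⊓ q, hp.inf hq, eq_zero_of_map_le hφ.nonneg (c := 1)
        (hp.inf hq).sub_nonneg (y := (e - p) + (e - q)) ?_ ?_, rfl⟩, 2, by norm_num, ?_⟩
      · rw [map_add, hp0, hq0, add_zero]
      · rwa [one_smul]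
      · rw [two_smul, sub_inf]
        exact add_le_add (add_le_add_right le_sup_left _) (add_le_add_right le_sup_right _))
    (by
      rintro _ ⟨p, hp, hp0, rfl⟩ C hC hle
      exact hcon p hp hp0 C hC hle)
  have hψ1' : ψ e = 1 := hψ1
  have hx : ψ x = 1 := by
    have h1 := hψS _ heS
    rw [sub_self, add_zero, ← hψ, abs_eq_zero, map_sub, hψ1'] at h1
    linarith
  obtain ⟨p, hp, hp0, hp1⟩ := exists_component_separating he h hφ1 hφ hψ1 hψ hφx hx
  have h2 := hψS _ ⟨p, hp, hp0, rfl⟩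
  rw [map_add, ← hψ, map_sub, map_sub, hx, hψ1', hp1] at h2
  norm_num at h2

/-- The second compactness argument: the admissible `p` are closed under `⊔`, and a common zero `φ`
of all `|x| + p` has `φ x = 0`, so some admissible `p` has `φ p = 1`. -/
lemma exists_component_separating_zero_one (he : 0 < e) (hunit : IsStrongUnit e)
    (h : ∀ H : L →ₗ[ℝ] ℝ, IsUnital e H → PreservesUnits H → IsRieszHom H) (x : L) :
    ∃ p, IsComponent e p ∧ (∃ C : ℝ, 0 ≤ C ∧ e ≤ C • (|x - e| + (e - p))) ∧
      ∃ C : ℝ, 0 ≤ C ∧ e ≤ C • (|x| + p) := by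
  by_contra! hcon
  let S : Set L := {a | ∃ p, IsComponent e p ∧
    (∃ C : ℝ, 0 ≤ C ∧ e ≤ C • (|x - e| + (e - p))) ∧ a = |x| + p}
  have h0S : |x| + 0 ∈ S := by
    refine ⟨0, by simp [IsComponent, he.le], ⟨1, zero_le_one, ?_⟩, rfl⟩
    rw [one_smul, sub_zero]
    exact le_add_of_nonneg_left (abs_nonneg _)
  obtain ⟨φ, hφ1, hφ, hφS⟩ := exists_rieszHom_of_directed he.le hunit S ⟨_, h0S⟩
    (by
      rintro _ ⟨p, hp, -, rfl⟩
      exact add_nonneg (abs_nonneg _) hp.nonneg)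
    (by
      rintro _ ⟨p, hp, ⟨C, hC, hpC⟩, rfl⟩ _ ⟨q, hq, ⟨D, hD, hqD⟩, rfl⟩
      refine ⟨_, ⟨p ⊔ q, hp.sup hq, ⟨C + D + 1, by positivity, ?_⟩, rfl⟩, 2, by norm_num, ?_⟩
      · have hE : 0 < C + D + 1 := by positivity
        have hp2 := hpC.trans (smul_le_smul_of_nonneg_right (by linarith : C ≤ C + D + 1)
          (add_nonneg (abs_nonneg _) hp.sub_nonneg))
        have hq2 := hqD.trans (smul_le_smul_of_nonneg_right (by linarith : D ≤ C + D + 1)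
          (add_nonneg (abs_nonneg _) hq.sub_nonneg))
        rw [← inv_smul_le_iff_of_pos hE] at hp2 hq2 ⊢
        rw [sub_sup, add_inf]
        exact le_inf hp2 hq2
      · rw [two_smul]
        exact add_le_add (add_le_add_right le_sup_left _) (add_le_add_right le_sup_right _))
    (by
      rintro _ ⟨p, hp, ⟨C, hC, hpC⟩, rfl⟩ D hD hle
      exact hcon p hp ⟨C, hC, hpC⟩ D hD hle)
  have hφ1' : φ e = 1 := hφ1
  have hx : φ x = 0 := by
    have h1 := hφS _ h0S
    rwa [add_zero, ← hφ, abs_eq_zero] at h1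
  obtain ⟨p, hp, hp0, hC⟩ := exists_component_of_map_eq_zero he hunit h hφ1 hφ hx
  have h2 := hφS _ ⟨p, hp, hC, rfl⟩
  rw [map_add, ← hφ, hx, abs_zero, zero_add] at h2
  rw [map_sub, h2, hφ1'] at hp0
  norm_num at hp0

theorem isCleanSet_of_forall_isRieszHom (he : 0 < e) (hunit : IsStrongUnit e)
    (h : ∀ H : L →ₗ[ℝ] ℝ, IsUnital e H → PreservesUnits H → IsRieszHom H) :
    IsCleanSet e (Set.univ : Set L) := fun x _ => by
  obtain ⟨p, hp, ⟨C, hC, hle⟩, D, hD, hle'⟩ :=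
    exists_component_separating_zero_one he hunit h x
  have hq := hp.sub_nonneg
  have hpq : (e - p) ⊓ p = 0 := (inf_comm _ _).trans hp
  have h1 : e - p ≤ D • |x - p| := by
    have h2 : |x| ≤ |x - p| + p := by
      have := abs_add_le (x - p) p
      rwa [sub_add_cancel, abs_of_nonneg hp.nonneg] at this
    -- One `D • p` comes from `hle'`, the other from replacing `|x|` by `|x - p| + p`; both drop
    -- out, `p` being disjoint from `e - p`.
    refine le_of_le_add_of_inf_eq_zero hq (smul_nonneg (by positivity) hp.nonneg)
      (smul_nonneg hD (abs_nonneg _)) (b := (2 * D) • p) ?_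
      (inf_smul_eq_zero hq hp.nonneg hpq (by positivity))
    refine (sub_le_self e hp.nonneg).trans (hle'.trans ?_)
    rw [show (2 * D) • p + D • |x - p| = D • (|x - p| + p + p) by module]
    exact smul_le_smul_of_nonneg_left (add_le_add_left h2 p) hD
  have h2 : p ≤ C • |x - p| := by
    have h3 : |x - e| ≤ |x - p| + (e - p) := by
      have := abs_add_le (x - p) (-(e - p))
      rwa [← sub_eq_add_neg, sub_sub_sub_cancel_right, abs_neg, abs_of_nonneg hq] at this
    refine le_of_le_add_of_inf_eq_zero hp.nonneg (smul_nonneg (by positivity) hq)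
      (smul_nonneg hC (abs_nonneg _)) (b := (2 * C) • (e - p)) ?_
      (inf_smul_eq_zero hp.nonneg hq hp (by positivity))
    refine (sub_nonneg.1 hq).trans (hle.trans ?_)
    rw [show (2 * C) • (e - p) + C • |x - p| = C • (|x - p| + (e - p) + (e - p)) by module]
    exact smul_le_smul_of_nonneg_left (add_le_add_left h3 _) hC
  refine ⟨p, x - p, hp, .of_le (c := C + D + 1) he.le hunit (by positivity) ?_, by abel⟩
  have h3 := add_le_add h2 h1
  rw [add_sub_cancel, ← add_smul] at h3
  exact h3.trans (smul_le_smul_of_nonneg_right (by linarith) (abs_nonneg _))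

end RieszImpliesClean

end RieszSpace

theorem mainTheorem3 {L : Type*} [AddCommGroup L] [Lattice L] [IsOrderedAddMonoid L]
    [Module ℝ L] [IsOrderedModule ℝ L] (e : L) (he : 0 < e) (hunit : RieszSpace.IsStrongUnit e) :
    (∀ H : L →ₗ[ℝ] ℝ, RieszSpace.IsUnital e H → RieszSpace.PreservesUnits H →
        RieszSpace.IsRieszHom H) ↔
      RieszSpace.IsCleanSet e (Set.univ : Set L) :=
  ⟨RieszSpace.isCleanSet_of_forall_isRieszHom he hunit,
    fun hclean _ h1 hH => RieszSpace.isRieszHom_of_isCleanSet he hunit hclean h1 hH⟩
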